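/- Let $\mu,\nu$ be probability measures on $\mathbb{R}^d$, where $\mu$ is absolutely continuous with respect to Lebesgue measure. For $t>0$ let $q_t(\cdot\mid x)$ be the density of $\mathcal N(e^{-t}x,(1-e^{-2t})I)$. For a probability measure $\rho$ let $q_t^\rho$ be the law at time $t$ of the Ornstein–Uhlenbeck process $dX_t=-X_t\,dt+\sqrt2\,dB_t$ with $X_0\sim\rho$, that is, $q_0^\rho=\rho$ and $q_t^\rho(y)=\int q_t(y\mid x)\,d\rho(x)$ for $t>0$. For $y\in\mathbb{R}^d$ and $t>0$ let $\mu_{y,t}$ be the probability measure with $\mu_{y,t}(dx)\propto q_t(y\mid x)\,\mu(dx)$. For probability measures $\rho,\pi$ on $\mathbb{R}^d$ write $$\mathrm{KL}(\rho\,\Vert\,\pi)=\int\log\frac{d\rho}{d\pi}\,d\rho,\qquad \mathrm{FI}(\rho\,\Vert\,\pi)=\int\Bigl\|\nabla\log\frac{d\rho}{d\pi}\Bigr\|^2d\rho,\qquad \mathrm{FI}_\infty(\rho\,\Vert\,\pi)=\Bigl\|\nabla\log\frac{d\rho}{d\pi}\Bigr\|_{L^\infty(\rho)}^2 .$$ Here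 $\mathrm{KL}=+\infty$ unless $\rho\ll\pi$ and $\log\frac{d\rho}{d\pi}\in L^1(\rho)$. If $\rho=f\pi$ for some $f\ge0$ in $L^1_{\mathrm{loc}}(\mathbb{R}^d)$ with a weak gradient $\nabla f\in L^1_{\mathrm{loc}}(\mathbb{R}^d)$, then $\nabla\log\frac{d\rho}{d\pi}=\nabla f/f$; if there is no such $f$, then $\mathrm{FI}=\mathrm{FI}_\infty=+\infty$. (If there are several such $f$, take the infimum over them; when $\pi$ is absolutely continuous with respect to Lebesgue measure they all give the same value.) We say that $\pi$ satisfies a log-Sobolev inequality with constant $\lambda>0$ if $\mathrm{KL}(\rho\,\Vert\,\pi)\le\frac{\lambda}{2}\,\mathrm{FI}(\rho\,\Vert\,\pi)$ for all probability measures $\rho$. Let $(\lambda_t)_{t\ge0}$ be positive constants such that, for all $y\in\mathbb{R}^d$ and $t>0$, the measure $\mu_{y,t}$ satisfies a log-Sobolev inequality with constant $\lambda_t$. Then, for all $s\ge0$, $$\sqrt{\mathrm{FI}_\infty(q_s^\nu\,\Vert\,q_s^\mu)}\;\le\;\frac{e^s\lambda_s}{e^{2s}-1}\,\sqrt{\mathrm{FI}_\infty(\nu\,\Vert\,\mu)},$$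 as an inequality in $[0,+\infty]$, where for $s=0$ the prefactor is read as $+\infty$, with $+\infty\cdot0=0$. -/

import Mathlib

open MeasureTheory InformationTheory

/-- `G` is the weak (distributional) gradient of `f` on `ℝ^d`, both being locally integrable:
`∫ f ∂_v φ = - ∫ φ ⟨G, v⟩` for all test functions `φ ∈ C_c^∞` and all directions `v`. -/
def HasWeakGradient {d : ℕ} (f : EuclideanSpace ℝ (Fin d) → ℝ)
    (G : EuclideanSpace ℝ (Fin d) → EuclideanSpace ℝ (Fin d)) : Prop :=
  LocallyIntegrable f volume ∧ LocallyIntegrable G volume ∧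
    ∀ φ : EuclideanSpace ℝ (Fin d) → ℝ, ContDiff ℝ (⊤ : ℕ∞) φ → HasCompactSupport φ →
      ∀ v : EuclideanSpace ℝ (Fin d),
        ∫ x, f x * fderiv ℝ φ x v = - ∫ x, φ x * inner ℝ (G x) v

/-- `ν = f μ` with a nonnegative relative density `f` that has the weak gradient `G`.
In this case `∇ log (ν/μ) = f⁻¹ G`, which makes sense `ν`-almost everywhere because `f > 0` holds
`ν`-almost everywhere. -/
structure IsRelDensity {d : ℕ} (ν μ : Measure (EuclideanSpace ℝ (Fin d)))
    (f : EuclideanSpace ℝ (Fin d) → ℝ)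
    (G : EuclideanSpace ℝ (Fin d) → EuclideanSpace ℝ (Fin d)) : Prop where
  nonneg : ∀ x, 0 ≤ f x
  eq_withDensity : ν = μ.withDensity (fun x => ENNReal.ofReal (f x))
  weakGradient : HasWeakGradient f G

/-- Relative Fisher information `FI(ν‖μ) = ∫ ‖∇ log (ν/μ)‖² dν`, equal to `+∞` if `ν` is not
absolutely continuous with respect to `μ` or if the relative density is not weakly differentiable.

If `μ` is absolutely continuous with respect to Lebesgue measure, then `f` is determined a.e. on the
set where the density of `μ` is positive, hence so is `G` (weak gradients of two functions agree
almost everywhere on the set where the functions agree). So all pairs `(f, G)` give the same value,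
and the infimum only implements the convention `+∞` when there is no such pair. -/
noncomputable def fisherInfo {d : ℕ} (ν μ : Measure (EuclideanSpace ℝ (Fin d))) : ENNReal :=
  ⨅ (f : EuclideanSpace ℝ (Fin d) → ℝ)
    (G : EuclideanSpace ℝ (Fin d) → EuclideanSpace ℝ (Fin d))
    (_ : IsRelDensity ν μ f G), ∫⁻ x, ‖(f x)⁻¹ • G x‖ₑ ^ 2 ∂ν

/-- `FI_∞(ν‖μ) = ‖∇ log (ν/μ)‖²_{L^∞(ν)}`, with the same conventions as for `fisherInfo`. -/
noncomputable def fisherInfoTop {d : ℕ} (ν μ : Measure (EuclideanSpace ℝ (Fin d))) : ENNReal :=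
  ⨅ (f : EuclideanSpace ℝ (Fin d) → ℝ)
    (G : EuclideanSpace ℝ (Fin d) → EuclideanSpace ℝ (Fin d))
    (_ : IsRelDensity ν μ f G), eLpNorm (fun x => (f x)⁻¹ • G x) ⊤ ν ^ 2

/-- Log-Sobolev inequality with constant `lam`: `KL(ν‖μ) ≤ (lam / 2) FI(ν‖μ)` for all probability
measures `ν`. -/
def LogSobolev {d : ℕ} (μ : Measure (EuclideanSpace ℝ (Fin d))) (lam : ℝ) : Prop :=
  ∀ ν : Measure (EuclideanSpace ℝ (Fin d)), IsProbabilityMeasure ν →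
    klDiv ν μ ≤ ENNReal.ofReal (lam / 2) * fisherInfo ν μ

/-- For `t > 0`, the Ornstein–Uhlenbeck transition density `q_t(y | x)`: the density at `y` of the
Gaussian `N(e^{-t} x, (1 - e^{-2t}) I)`. -/
noncomputable def ouDensity {d : ℕ} (t : ℝ) (x y : EuclideanSpace ℝ (Fin d)) : ℝ :=
  (2 * Real.pi * (1 - Real.exp (-2 * t))) ^ (-(d : ℝ) / 2) *
    Real.exp (-‖y - Real.exp (-t) • x‖ ^ 2 / (2 * (1 - Real.exp (-2 * t))))

/-- The law at time `t ≥ 0` of the Ornstein–Uhlenbeck process `dX = -X dt + √2 dB` with `X_0 ∼ ρ`: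
it is `ρ` at `t = 0`, and for `t > 0` its Lebesgue density is `y ↦ ∫ q_t(y | x) dρ(x)`. -/
noncomputable def ouLaw {d : ℕ} (ρ : Measure (EuclideanSpace ℝ (Fin d))) (t : ℝ) :
    Measure (EuclideanSpace ℝ (Fin d)) :=
  if t = 0 then ρ
  else volume.withDensity (fun y => ∫⁻ x, ENNReal.ofReal (ouDensity t x y) ∂ρ)

/-- For `t > 0`, the probability measure `μ_{y,t}(dx) ∝ q_t(y | x) μ(dx)`. -/
noncomputable def ouTilt {d : ℕ} (μ : Measure (EuclideanSpace ℝ (Fin d)))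
    (y : EuclideanSpace ℝ (Fin d)) (t : ℝ) : Measure (EuclideanSpace ℝ (Fin d)) :=
  (∫⁻ x, ENNReal.ofReal (ouDensity t x y) ∂μ)⁻¹ •
    μ.withDensity (fun x => ENNReal.ofReal (ouDensity t x y))

/-! By Tweedie's formula, the score of a smoothed law at `y` is affine in the mean of the tilted
measure at `y`. So the relative score of `q_s^ν` against `q_s^μ` at `y` is `e^{-s}/(1-e^{-2s})`
times the difference `w` of the means of `ν_{y,s}` and `μ_{y,s}` (`inner_ouLawDensityGrad`). Tilting
both measures by the same kernel changes their relative density only by a constant, so the score of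
`ν_{y,s}` against `μ_{y,s}` is that of `ν` against `μ`, bounded by some `L` (`IsRelDensity.ouTilt`).

It remains to show `‖w‖ ≤ λ L` (`LogSobolev.norm_le_of_inner_eq`). The log-Sobolev inequality bounds
the entropy by `λL²/2`, and Herbst's argument makes linear functions sub-Gaussian under `μ_{y,s}`.
Donsker–Varadhan then gives `⟨w,v⟩ ≤ λL²/2 + λ‖v‖²/2` for every `v`, and one optimizes over `v`. -/

/-! ### Entropy of exponential tilts -/

/-- Donsker–Varadhan variational inequality. -/
theorem integral_le_klDiv_add_log {α : Type*} [MeasurableSpace α] {ρ π : Measure α}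
    [IsProbabilityMeasure ρ] [IsProbabilityMeasure π] (hkl : klDiv ρ π ≠ ⊤) {g : α → ℝ}
    (hgρ : Integrable g ρ) (hgπ : Integrable (fun x => Real.exp (g x)) π) :
    ∫ x, g x ∂ρ ≤ (klDiv ρ π).toReal + Real.log (∫ x, Real.exp (g x) ∂π) := by
  obtain ⟨hac, hint⟩ := klDiv_ne_top_iff.mp hkl
  have := isProbabilityMeasure_tilted hgπ
  have h1 := integral_llr_tilted_right hac hgρ hgπ hint
  have h2 := integral_llr_add_sub_measure_univ_nonneg
    (hac.trans (absolutelyContinuous_tilted hgπ)) (integrable_llr_tilted_right hac hgρ hint hgπ)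
  rw [toReal_klDiv_of_measure_eq hac (by simp)]
  simp only [probReal_univ] at h2
  linarith

theorem toReal_klDiv_tilted {α : Type*} [MeasurableSpace α] {π : Measure α}
    [IsProbabilityMeasure π] {g : α → ℝ} (hg : Integrable (fun x => Real.exp (g x)) π)
    (hgt : Integrable g (π.tilted g)) :
    (klDiv (π.tilted g) π).toReal
      = ∫ x, g x ∂(π.tilted g) - Real.log (∫ x, Real.exp (g x) ∂π) := by
  have := isProbabilityMeasure_tilted hg
  rw [toReal_klDiv_of_measure_eq (tilted_absolutelyContinuous _ _) (by simp)]
  have h : llr (π.tilted g) π =ᵐ[π.tilted g]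
      fun x => g x - Real.log (∫ x, Real.exp (g x) ∂π) :=
    (tilted_absolutelyContinuous _ _).ae_le (log_rnDeriv_tilted_left_self hg)
  rw [integral_congr_ae h, integral_sub hgt (integrable_const _)]
  simp

/-! ### Weak gradients, Fisher information and Herbst's argument -/

section WeakGradient

variable {d : ℕ}

local notation "E" => EuclideanSpace ℝ (Fin d)

/-- Classical integration by parts; compact support of the test function provides all the
integrability. -/
theorem hasWeakGradient_of_hasGradientAt {f : E → ℝ} {G : E → E}
    (hf : ∀ x, HasGradientAt f (G x) x) (hG : Continuous G) : HasWeakGradient f G := by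
  have hfd : Differentiable ℝ f := fun x => (hf x).differentiableAt
  refine ⟨hfd.continuous.locallyIntegrable, hG.locallyIntegrable, fun φ hφ hc v => ?_⟩
  have hφ1 : ContDiff ℝ 1 φ := hφ.of_le (by simp)
  have hdφ : Continuous fun x => fderiv ℝ φ x v :=
    (hφ1.continuous_fderiv (by simp)).clm_apply continuous_const
  have hfv : ∀ x, fderiv ℝ f x v = inner ℝ (G x) v := fun x => by
    rw [(hf x).hasFDerivAt.fderiv]; simp
  have hcd : HasCompactSupport fun x => fderiv ℝ φ x v :=
    (hc.fderiv ℝ).comp_left (g := fun L : E →L[ℝ] ℝ => L v) (by simp)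
  rw [integral_mul_fderiv_eq_neg_fderiv_mul_of_integrable]
  · congr 1
    refine integral_congr_ae (.of_forall fun x => ?_)
    simp only [hfv]
    ring
  · simp only [hfv]
    exact ((hG.inner continuous_const).mul hφ1.continuous).integrable_of_hasCompactSupport
      hc.mul_left
  · exact (hfd.continuous.mul hdφ).integrable_of_hasCompactSupport hcd.mul_left
  · exact (hfd.continuous.mul hφ1.continuous).integrable_of_hasCompactSupport hc.mul_left
  · exact fun x _ => hfd x
  · exact fun x _ => hφ1.differentiable (by simp) x

theorem HasWeakGradient.const_mul {f : E → ℝ} {G : E → E} (h : HasWeakGradient f G) (c : ℝ) :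
    HasWeakGradient (fun x => c * f x) (fun x => c • G x) := by
  refine ⟨h.1.smul c, h.2.1.smul c, fun φ hφ hc v => ?_⟩
  have := h.2.2 φ hφ hc v
  simp only [mul_assoc, integral_const_mul, this, mul_neg]
  rw [← integral_const_mul]
  congr 2 with x
  rw [real_inner_smul_left]
  ring

theorem fisherInfo_le {ρ π : Measure E} {f : E → ℝ} {G : E → E} (h : IsRelDensity ρ π f G) :
    fisherInfo ρ π ≤ ∫⁻ x, ‖(f x)⁻¹ • G x‖ₑ ^ 2 ∂ρ :=
  iInf_le_of_le f <| iInf_le_of_le G <| iInf_le _ h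

theorem fisherInfoTop_le {ρ π : Measure E} {f : E → ℝ} {G : E → E} (h : IsRelDensity ρ π f G) :
    fisherInfoTop ρ π ≤ eLpNorm (fun x => (f x)⁻¹ • G x) ⊤ ρ ^ 2 :=
  iInf_le_of_le f <| iInf_le_of_le G <| iInf_le _ h

theorem isRelDensity_tilted (π : Measure E) (v : E) :
    IsRelDensity (π.tilted fun x => inner ℝ v x) π
      (fun x => (∫ z, Real.exp (inner ℝ v z) ∂π)⁻¹ * Real.exp (inner ℝ v x))
      (fun x => (∫ z, Real.exp (inner ℝ v z) ∂π)⁻¹ • Real.exp (inner ℝ v x) • v) := by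
  refine ⟨fun x => by positivity, ?_, HasWeakGradient.const_mul ?_ _⟩
  · simp only [Measure.tilted, div_eq_inv_mul]
  · refine hasWeakGradient_of_hasGradientAt (fun x => ?_) (by fun_prop)
    have h : HasGradientAt (fun x : E => inner ℝ v x) v x := by
      rw [hasGradientAt_iff_hasFDerivAt]
      exact (InnerProductSpace.toDual ℝ E v).hasFDerivAt
    rw [hasGradientAt_iff_hasFDerivAt] at h ⊢
    simpa using h.exp

/-- The score of a linear exponential tilt is the constant vector `v`. One admissible pair suffices
for an upper bound on the infimum. -/
theorem fisherInfo_tilted_le (π : Measure E) [IsProbabilityMeasure π] (v : E)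
    (hv : Integrable (fun x => Real.exp (inner ℝ v x)) π) :
    fisherInfo (π.tilted fun x => inner ℝ v x) π ≤ ENNReal.ofReal (‖v‖ ^ 2) := by
  have := isProbabilityMeasure_tilted hv
  refine (fisherInfo_le (isRelDensity_tilted π v)).trans ?_
  have hZ := (integral_exp_pos hv).ne'
  have h : ∀ x : E, ‖((∫ z, Real.exp (inner ℝ v z) ∂π)⁻¹ * Real.exp (inner ℝ v x))⁻¹ •
      (∫ z, Real.exp (inner ℝ v z) ∂π)⁻¹ • Real.exp (inner ℝ v x) • v‖ₑ ^ 2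
      = ENNReal.ofReal (‖v‖ ^ 2) := fun x => by
    have : ((∫ z, Real.exp (inner ℝ v z) ∂π)⁻¹ * Real.exp (inner ℝ v x)) ≠ 0 := by positivity
    rw [← mul_smul _ _ v, inv_smul_smul₀ this, ← ofReal_norm, ENNReal.ofReal_pow (norm_nonneg _)]
  simp only [h, lintegral_const, measure_univ, mul_one, le_refl]

theorem fisherInfo_le_of_ae_bound {ρ π : Measure E} [IsProbabilityMeasure ρ] {f : E → ℝ}
    {G : E → E} (h : IsRelDensity ρ π f G) {L : ℝ}
    (hL : ∀ᵐ x ∂ρ, ‖(f x)⁻¹ • G x‖ₑ ≤ ENNReal.ofReal L) :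
    fisherInfo ρ π ≤ ENNReal.ofReal L ^ 2 := by
  refine (fisherInfo_le h).trans ?_
  calc ∫⁻ x, ‖(f x)⁻¹ • G x‖ₑ ^ 2 ∂ρ ≤ ∫⁻ _, ENNReal.ofReal L ^ 2 ∂ρ := by
        refine lintegral_mono_ae ?_
        filter_upwards [hL] with x hx
        gcongr
    _ = _ := by simp

theorem LogSobolev.klDiv_tilted_le {π : Measure E} [IsProbabilityMeasure π] {lam : ℝ}
    (h : LogSobolev π lam) (hlam : 0 < lam) (v : E)
    (hv : Integrable (fun x => Real.exp (inner ℝ v x)) π) :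
    (klDiv (π.tilted fun x => inner ℝ v x) π).toReal ≤ lam / 2 * ‖v‖ ^ 2 := by
  refine ENNReal.toReal_le_of_le_ofReal (by positivity) ?_
  rw [ENNReal.ofReal_mul (by positivity)]
  exact (h _ (isProbabilityMeasure_tilted hv)).trans
    (by gcongr; exact fisherInfo_tilted_le π v hv)

/-- Herbst's argument for linear functions. -/
theorem LogSobolev.log_integral_exp_inner_le {π : Measure E} [IsProbabilityMeasure π] {lam : ℝ}
    (h : LogSobolev π lam) (hlam : 0 < lam)
    (hexp : ∀ v : E, Integrable (fun x => Real.exp (inner ℝ v x)) π) (v : E) :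
    Real.log (∫ x, Real.exp (inner ℝ v x) ∂π) ≤ ∫ x, inner ℝ v x ∂π + lam / 2 * ‖v‖ ^ 2 := by
  set X : E → ℝ := fun x => inner ℝ v x with hX
  set K := ProbabilityTheory.cgf X π with hK
  have hset : ProbabilityTheory.integrableExpSet X π = Set.univ := by
    refine Set.eq_univ_of_forall fun t => ?_
    simpa [ProbabilityTheory.integrableExpSet, hX, inner_smul_left] using hexp (t • v)
  have hmem : ∀ t, t ∈ interior (ProbabilityTheory.integrableExpSet X π) := by simp [hset]
  have hKd : Differentiable ℝ K := fun t =>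
    (ProbabilityTheory.analyticAt_cgf (hmem t)).differentiableAt
  -- The left side is the entropy of the tilt by `a • v`, whose mean of `X` is `K'(a)`.
  have hmain : ∀ a, a * deriv K a - K a ≤ lam / 2 * (a ^ 2 * ‖v‖ ^ 2) := fun a => by
    have h1 := h.klDiv_tilted_le hlam (a • v) (hexp _)
    have h2 : (fun x : E => (inner ℝ (a • v) x : ℝ)) = fun x => a * X x := by
      ext x; simp [hX, inner_smul_left]
    rw [h2, toReal_klDiv_tilted] at h1
    · rw [integral_const_mul, ProbabilityTheory.integral_tilted_mul_self (hmem a), norm_smul,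
        mul_pow, Real.norm_eq_abs, sq_abs] at h1
      exact h1
    · simpa only [hX, real_inner_smul_left] using hexp (a • v)
    · exact ((ProbabilityTheory.memLp_tilted_mul (hmem a) 1).integrable (by simp)).const_mul a
  have hK0 : K 0 = 0 := ProbabilityTheory.cgf_zero
  -- Dividing `hmain` by `a²` bounds the derivative of `K(a)/a`. Using `dslope` fills in the value
  -- `K'(0)`, the mean of `X`, at `a = 0`; the claim compares `a = 0` with `a = 1`.
  have hanti : AntitoneOn (fun a => dslope K 0 a - lam / 2 * ‖v‖ ^ 2 * a) (Set.Icc 0 1) := by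
    have hev : ∀ a : ℝ, 0 < a → HasDerivAt (fun a => dslope K 0 a - lam / 2 * ‖v‖ ^ 2 * a)
        ((deriv K a * a - K a * 1) / a ^ 2 - lam / 2 * ‖v‖ ^ 2 * 1) a := fun a ha => by
      have hd := (((hKd a).hasDerivAt.div (hasDerivAt_id' a) ha.ne').sub
        ((hasDerivAt_id' a).const_mul (lam / 2 * ‖v‖ ^ 2)))
      refine hd.congr_of_eventuallyEq ?_
      filter_upwards [lt_mem_nhds ha] with b hb
      simp [dslope_of_ne _ hb.ne', slope_def_field, hK0]
    refine antitoneOn_of_deriv_nonpos (convex_Icc _ _) ?_ ?_ ?_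
    · refine ContinuousOn.sub (fun a _ => ?_) (by fun_prop)
      rcases eq_or_ne a 0 with rfl | ha
      · exact (continuousAt_dslope_same.mpr (hKd 0)).continuousWithinAt
      · exact ((continuousAt_dslope_of_ne ha).mpr (hKd a).continuousAt).continuousWithinAt
    · rw [interior_Icc]
      exact fun a ha => (hev a ha.1).differentiableAt.differentiableWithinAt
    · rw [interior_Icc]
      intro a ha
      rw [(hev a ha.1).deriv, sub_nonpos, div_le_iff₀ (pow_pos ha.1 2)]
      linarith [hmain a]
  have h01 := hanti (by simp) (by simp) zero_le_one
  have hK1 : K 1 = Real.log (∫ x, Real.exp (X x) ∂π) := by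
    simp [hK, ProbabilityTheory.cgf, ProbabilityTheory.mgf]
  simp only [dslope_same, dslope_of_ne K one_ne_zero, slope_def_field, hK0, sub_zero, div_one,
    hK1] at h01
  rw [hK, ProbabilityTheory.deriv_cgf_zero (hmem 0), probReal_univ] at h01
  linarith

/-- Under a log-Sobolev inequality, the means of `ρ` and `π` differ by at most `lam * L` if the
relative score of `ρ` is bounded by `L`. -/
theorem LogSobolev.norm_le_of_inner_eq {ρ π : Measure E} [IsProbabilityMeasure ρ]
    [IsProbabilityMeasure π] {lam : ℝ} (h : LogSobolev π lam) (hlam : 0 < lam)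
    (hexp : ∀ v : E, Integrable (fun x => Real.exp (inner ℝ v x)) π)
    (hint : ∀ v : E, Integrable (fun x => (inner ℝ v x : ℝ)) ρ)
    {f : E → ℝ} {G : E → E} (hd : IsRelDensity ρ π f G) {L : ℝ} (hL0 : 0 ≤ L)
    (hL : ∀ᵐ x ∂ρ, ‖(f x)⁻¹ • G x‖ₑ ≤ ENNReal.ofReal L) {w : E}
    (hw : ∀ v : E, inner ℝ w v = ∫ x, inner ℝ v x ∂ρ - ∫ x, inner ℝ v x ∂π) :
    ‖w‖ ≤ lam * L := by
  have hkl : klDiv ρ π ≤ ENNReal.ofReal (lam / 2 * L ^ 2) := by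
    rw [ENNReal.ofReal_mul (by positivity), ENNReal.ofReal_pow hL0]
    exact (h ρ inferInstance).trans (by gcongr; exact fisherInfo_le_of_ae_bound hd hL)
  have hkl' := ENNReal.toReal_le_of_le_ofReal (by positivity) hkl
  have key : ∀ v : E, inner ℝ w v ≤ lam / 2 * L ^ 2 + lam / 2 * ‖v‖ ^ 2 := fun v => by
    have h1 := integral_le_klDiv_add_log (hkl.trans_lt ENNReal.ofReal_lt_top).ne (hint v) (hexp v)
    have h2 := h.log_integral_exp_inner_le hlam hexp v
    rw [hw]
    linarith
  -- This `v` maximizes `⟨w,v⟩ - λ‖v‖²/2`.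
  have h3 := key (lam⁻¹ • w)
  rw [inner_smul_right, real_inner_self_eq_norm_sq, norm_smul, Real.norm_eq_abs,
    abs_of_pos (inv_pos.mpr hlam)] at h3
  refine abs_le_of_sq_le_sq' ?_ (by positivity) |>.2
  field_simp at h3
  nlinarith

end WeakGradient

/-! ### The Ornstein–Uhlenbeck kernel and its gradient -/

section OrnsteinUhlenbeck

variable {d : ℕ} {t : ℝ}

local notation "E" => EuclideanSpace ℝ (Fin d)

theorem one_sub_exp_neg_two_mul_pos (ht : 0 < t) : 0 < 1 - Real.exp (-2 * t) := by
  rw [sub_pos, Real.exp_lt_one_iff]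
  linarith

/-- The maximal value of the Ornstein–Uhlenbeck transition density. -/
noncomputable def ouDensityMax (d : ℕ) (t : ℝ) : ℝ :=
  (2 * Real.pi * (1 - Real.exp (-2 * t))) ^ (-(d : ℝ) / 2)

theorem ouDensityMax_pos (d : ℕ) (ht : 0 < t) : 0 < ouDensityMax d t :=
  Real.rpow_pos_of_pos (mul_pos (by positivity) (one_sub_exp_neg_two_mul_pos ht)) _

theorem ouDensity_eq (t : ℝ) (x y : E) : ouDensity t x y = ouDensityMax d t *
    Real.exp (-‖y - Real.exp (-t) • x‖ ^ 2 / (2 * (1 - Real.exp (-2 * t)))) := rfl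

theorem ouDensity_pos (ht : 0 < t) (x y : E) : 0 < ouDensity t x y :=
  mul_pos (ouDensityMax_pos d ht) (Real.exp_pos _)

theorem ouDensity_le (ht : 0 < t) (x y : E) : ouDensity t x y ≤ ouDensityMax d t := by
  have := one_sub_exp_neg_two_mul_pos ht
  refine mul_le_of_le_one_right (ouDensityMax_pos d ht).le (Real.exp_le_one_iff.mpr ?_)
  exact div_nonpos_of_nonpos_of_nonneg (by simp) (by positivity)

theorem continuous_ouDensity_left (t : ℝ) (y : E) : Continuous fun x => ouDensity t x y := by
  unfold ouDensity; fun_prop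

theorem continuous_ouDensity_right (t : ℝ) (x : E) : Continuous fun y => ouDensity t x y := by
  unfold ouDensity; fun_prop

theorem integrable_ouDensity (ht : 0 < t) (ρ : Measure E) [IsFiniteMeasure ρ] (y : E) :
    Integrable (fun x => ouDensity t x y) ρ :=
  .of_bound (continuous_ouDensity_left t y).aestronglyMeasurable (ouDensityMax d t)
    (.of_forall fun x => by
      rw [Real.norm_of_nonneg (ouDensity_pos ht x y).le]; exact ouDensity_le ht x y)

/-- The gradient of the transition density in its second variable. -/
noncomputable def ouDensityGrad (t : ℝ) (x y : E) : E :=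
  -(ouDensity t x y / (1 - Real.exp (-2 * t))) • (y - Real.exp (-t) • x)

theorem hasGradientAt_ouDensity (ht : 0 < t) (x y : E) :
    HasGradientAt (fun y => ouDensity t x y) (ouDensityGrad t x y) y := by
  have hs := (one_sub_exp_neg_two_mul_pos ht).ne'
  rw [hasGradientAt_iff_hasFDerivAt]
  have h := (((((hasFDerivAt_id y).sub_const (Real.exp (-t) • x)).norm_sq.neg.mul_const
    (2 * (1 - Real.exp (-2 * t)))⁻¹)).exp).const_mul (ouDensityMax d t)
  simp only [← div_eq_mul_inv] at h
  refine h.congr_fderiv ?_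
  ext v
  simp [ouDensityGrad, ouDensity_eq]
  field_simp

/-- With `σ = 1 - e^{-2t} ≤ 1`, one has `r ≤ 1 + r²/2 ≤ exp(r²/(2σ))`. The bound is uniform in `x`
and `y`, so it dominates when differentiating under the integral. -/
theorem norm_ouDensityGrad_le (ht : 0 < t) (x y : E) :
    ‖ouDensityGrad t x y‖ ≤ ouDensityMax d t / (1 - Real.exp (-2 * t)) := by
  have hs := one_sub_exp_neg_two_mul_pos ht
  have hM := ouDensityMax_pos d ht
  rw [ouDensityGrad, norm_smul, norm_neg, Real.norm_of_nonneg
    (div_nonneg (ouDensity_pos ht x y).le hs.le), ouDensity_eq, div_mul_eq_mul_div]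
  gcongr
  rw [mul_assoc]
  refine mul_le_of_le_one_right hM.le ?_
  set r := ‖y - Real.exp (-t) • x‖
  rw [neg_div, Real.exp_neg, inv_mul_le_iff₀ (Real.exp_pos _), mul_one]
  have h1 : r ^ 2 / 2 ≤ r ^ 2 / (2 * (1 - Real.exp (-2 * t))) := by
    gcongr
    linarith [Real.exp_pos (-2 * t)]
  have h2 := Real.add_one_le_exp (r ^ 2 / (2 * (1 - Real.exp (-2 * t))))
  nlinarith [sq_nonneg (r - 1)]

theorem continuous_ouDensityGrad_left (t : ℝ) (y : E) :
    Continuous fun x => ouDensityGrad t x y := by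
  have := continuous_ouDensity_left t y
  unfold ouDensityGrad; fun_prop

theorem continuous_ouDensityGrad_right (t : ℝ) (x : E) :
    Continuous fun y => ouDensityGrad t x y := by
  have := continuous_ouDensity_right t x
  unfold ouDensityGrad; fun_prop

theorem integrable_ouDensityGrad (ht : 0 < t) (ρ : Measure E) [IsFiniteMeasure ρ] (y : E) :
    Integrable (fun x => ouDensityGrad t x y) ρ :=
  .of_bound (continuous_ouDensityGrad_left t y).aestronglyMeasurable _
    (.of_forall fun x => norm_ouDensityGrad_le ht x y)

/-! ### Densities of the smoothed laws -/

/-- The Lebesgue density of `ouLaw ρ t`, as a real-valued function. -/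
noncomputable def ouLawDensity (ρ : Measure E) (t : ℝ) (y : E) : ℝ :=
  ∫ x, ouDensity t x y ∂ρ

/-- The gradient of `ouLawDensity`. -/
noncomputable def ouLawDensityGrad (ρ : Measure E) (t : ℝ) (y : E) : E :=
  ∫ x, ouDensityGrad t x y ∂ρ

theorem ouLawDensity_pos (ht : 0 < t) (ρ : Measure E) [IsProbabilityMeasure ρ] (y : E) :
    0 < ouLawDensity ρ t y := by
  rw [ouLawDensity, integral_pos_iff_support_of_nonneg (fun x => (ouDensity_pos ht x y).le)
    (integrable_ouDensity ht ρ y)]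
  simp [Function.support, (ouDensity_pos ht _ y).ne']

theorem lintegral_ouDensity (ht : 0 < t) (ρ : Measure E) [IsProbabilityMeasure ρ] (y : E) :
    ∫⁻ x, ENNReal.ofReal (ouDensity t x y) ∂ρ = ENNReal.ofReal (ouLawDensity ρ t y) :=
  (ofReal_integral_eq_lintegral_ofReal (integrable_ouDensity ht ρ y)
    (.of_forall fun x => (ouDensity_pos ht x y).le)).symm

theorem hasGradientAt_ouLawDensity (ht : 0 < t) (ρ : Measure E) [IsProbabilityMeasure ρ]
    (y : E) : HasGradientAt (ouLawDensity ρ t) (ouLawDensityGrad ρ t y) y := by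
  have hcont : Continuous fun x => InnerProductSpace.toDual ℝ E (ouDensityGrad t x y) :=
    (InnerProductSpace.toDual ℝ E).continuous.comp (continuous_ouDensityGrad_left t y)
  have hbd : ∀ x z : E, ‖InnerProductSpace.toDual ℝ E (ouDensityGrad t x z)‖
      ≤ ouDensityMax d t / (1 - Real.exp (-2 * t)) := fun x z => by
    simpa using norm_ouDensityGrad_le ht x z
  rw [hasGradientAt_iff_hasFDerivAt]
  refine (hasFDerivAt_integral_of_dominated_of_fderiv_le (μ := ρ)
    (F := fun y x => ouDensity t x y)
    (F' := fun y x => InnerProductSpace.toDual ℝ E (ouDensityGrad t x y)) Filter.univ_mem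
    (.of_forall fun z => (continuous_ouDensity_left t z).aestronglyMeasurable)
    (integrable_ouDensity ht ρ y) hcont.aestronglyMeasurable
    (.of_forall fun x z _ => hbd x z) (integrable_const _)
    (.of_forall fun x z _ => (hasGradientAt_ouDensity ht x z).hasFDerivAt)).congr_fderiv ?_
  ext v
  rw [ContinuousLinearMap.integral_apply (.of_bound hcont.aestronglyMeasurable _
    (.of_forall fun x => hbd x y))]
  simp only [InnerProductSpace.toDual_apply_apply, ouLawDensityGrad]
  rw [real_inner_comm, ← integral_inner (integrable_ouDensityGrad ht ρ y)]
  simp only [real_inner_comm]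

theorem continuous_ouLawDensity (ht : 0 < t) (ρ : Measure E) [IsProbabilityMeasure ρ] :
    Continuous (ouLawDensity ρ t) :=
  continuous_iff_continuousAt.mpr fun y => (hasGradientAt_ouLawDensity ht ρ y).continuousAt

theorem continuous_ouLawDensityGrad (ht : 0 < t) (ρ : Measure E) [IsProbabilityMeasure ρ] :
    Continuous (ouLawDensityGrad ρ t) :=
  continuous_of_dominated (fun y => (continuous_ouDensityGrad_left t y).aestronglyMeasurable)
    (fun y => .of_forall fun x => norm_ouDensityGrad_le ht x y) (integrable_const _)
    (.of_forall fun x => continuous_ouDensityGrad_right t x)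

theorem ouLaw_eq_withDensity (ht : 0 < t) (ρ : Measure E) [IsProbabilityMeasure ρ] :
    ouLaw ρ t = volume.withDensity fun y => ENNReal.ofReal (ouLawDensity ρ t y) := by
  simp only [ouLaw, ht.ne', if_false, lintegral_ouDensity ht]

/-! ### Tilted measures and Tweedie's formula -/

theorem ouTilt_eq_withDensity (ht : 0 < t) (ρ : Measure E) [IsProbabilityMeasure ρ] (y : E) :
    ouTilt ρ y t = (ENNReal.ofReal (ouLawDensity ρ t y))⁻¹ •
      ρ.withDensity fun x => ENNReal.ofReal (ouDensity t x y) := by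
  rw [ouTilt, lintegral_ouDensity ht]

theorem ouTilt_eq_tilted (ht : 0 < t) (ρ : Measure E) [IsProbabilityMeasure ρ] (y : E) :
    ouTilt ρ y t = ρ.tilted fun x => Real.log (ouDensity t x y) := by
  rw [ouTilt_eq_withDensity ht, Measure.tilted, ← withDensity_smul' _ _ (by
    simpa using ouLawDensity_pos ht ρ y)]
  congr 1 with x
  simp only [Real.exp_log (ouDensity_pos ht _ _), Pi.smul_apply, smul_eq_mul]
  rw [← ENNReal.ofReal_inv_of_pos (ouLawDensity_pos ht ρ y), ← ENNReal.ofReal_mul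
    (inv_nonneg.mpr (ouLawDensity_pos ht ρ y).le), ← div_eq_inv_mul]
  rfl

theorem integrable_exp_log_ouDensity (ht : 0 < t) (ρ : Measure E) [IsProbabilityMeasure ρ]
    (y : E) : Integrable (fun x => Real.exp (Real.log (ouDensity t x y))) ρ := by
  simpa only [Real.exp_log (ouDensity_pos ht _ _)] using integrable_ouDensity ht ρ y

theorem isProbabilityMeasure_ouTilt (ht : 0 < t) (ρ : Measure E) [IsProbabilityMeasure ρ]
    (y : E) : IsProbabilityMeasure (ouTilt ρ y t) := by
  rw [ouTilt_eq_tilted ht]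
  exact isProbabilityMeasure_tilted (integrable_exp_log_ouDensity ht ρ y)

theorem ouTilt_absolutelyContinuous (ht : 0 < t) (ρ : Measure E) [IsProbabilityMeasure ρ]
    (y : E) : ouTilt ρ y t ≪ ρ := by
  rw [ouTilt_eq_tilted ht]
  exact tilted_absolutelyContinuous _ _

theorem integral_ouTilt (ht : 0 < t) (ρ : Measure E) [IsProbabilityMeasure ρ] (y : E)
    (g : E → ℝ) :
    ouLawDensity ρ t y * ∫ x, g x ∂(ouTilt ρ y t) = ∫ x, ouDensity t x y * g x ∂ρ := by
  have := (ouLawDensity_pos ht ρ y).ne'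
  rw [ouTilt_eq_tilted ht, integral_tilted, ← integral_const_mul]
  simp only [Real.exp_log (ouDensity_pos ht _ _), smul_eq_mul]
  congr 1 with x
  rw [← ouLawDensity]
  field_simp

theorem integrable_ouTilt_iff (ht : 0 < t) (ρ : Measure E) [IsProbabilityMeasure ρ] (y : E)
    (g : E → ℝ) :
    Integrable g (ouTilt ρ y t) ↔ Integrable (fun x => ouDensity t x y * g x) ρ := by
  rw [ouTilt_eq_tilted ht, integrable_tilted_iff (integrable_exp_log_ouDensity ht ρ y)]
  simp only [Real.exp_log (ouDensity_pos ht _ _), smul_eq_mul]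

/-- The Gaussian kernel absorbs any linear exponent, whatever the tails of `ρ`: completing the
square bounds the product uniformly in `x`. -/
theorem integrable_exp_inner_ouTilt (ht : 0 < t) (ρ : Measure E) [IsProbabilityMeasure ρ]
    (y v : E) : Integrable (fun x => Real.exp (inner ℝ v x)) (ouTilt ρ y t) := by
  have hs := one_sub_exp_neg_two_mul_pos ht
  rw [integrable_ouTilt_iff ht]
  refine .of_bound ((continuous_ouDensity_left t y).mul (by fun_prop)).aestronglyMeasurable
    (ouDensityMax d t * Real.exp (inner ℝ v (Real.exp t • y) +
      (1 - Real.exp (-2 * t)) * ‖Real.exp t • v‖ ^ 2 / 2)) (.of_forall fun x => ?_)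
  rw [Real.norm_of_nonneg (mul_pos (ouDensity_pos ht x y) (Real.exp_pos _)).le, ouDensity_eq,
    mul_assoc, ← Real.exp_add]
  refine mul_le_mul_of_nonneg_left (Real.exp_le_exp.mpr ?_) (ouDensityMax_pos d ht).le
  set s := 1 - Real.exp (-2 * t)
  set z := y - Real.exp (-t) • x with hz
  set u := Real.exp t • v with hu
  have hx : inner ℝ v x = inner ℝ v (Real.exp t • y) - inner ℝ u z := by
    rw [hu, hz, real_inner_smul_left, inner_sub_right, inner_smul_right, inner_smul_right,
      mul_sub, ← mul_assoc, ← Real.exp_add]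
    simp
  have h := sq_nonneg ‖z + s • u‖
  rw [norm_add_sq_real, norm_smul, inner_smul_right, real_inner_comm, Real.norm_of_nonneg hs.le]
    at h
  have h2 : -‖z‖ ^ 2 / (2 * s) ≤ inner ℝ u z + s * ‖u‖ ^ 2 / 2 := by
    rw [div_le_iff₀ (by positivity)]
    nlinarith
  rw [hx]
  linarith

theorem integrable_inner_ouTilt (ht : 0 < t) (ρ : Measure E) [IsProbabilityMeasure ρ]
    (y v : E) : Integrable (fun x => (inner ℝ v x : ℝ)) (ouTilt ρ y t) := by
  refine ((integrable_exp_inner_ouTilt ht ρ y v).add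
    (integrable_exp_inner_ouTilt ht ρ y (-v))).mono' (by fun_prop) (.of_forall fun x => ?_)
  simp only [Pi.add_apply, inner_neg_left, Real.norm_eq_abs]
  have h1 := Real.add_one_le_exp (inner ℝ v x : ℝ)
  have h2 := Real.add_one_le_exp (-inner ℝ v x : ℝ)
  have h3 := Real.exp_pos (inner ℝ v x : ℝ)
  have h4 := Real.exp_pos (-inner ℝ v x : ℝ)
  rcases abs_cases (inner ℝ v x : ℝ) with h | h <;> linarith

/-- Tweedie's formula: the kernel's gradient is the kernel times an affine function of `x`, so
integration produces the mean of the tilted measure. -/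
theorem inner_ouLawDensityGrad (ht : 0 < t) (ρ : Measure E) [IsProbabilityMeasure ρ]
    (y v : E) : inner ℝ (ouLawDensityGrad ρ t y) v = ouLawDensity ρ t y *
      ((Real.exp (-t) * ∫ x, inner ℝ v x ∂(ouTilt ρ y t) - inner ℝ v y)
        / (1 - Real.exp (-2 * t))) := by
  have hs := (one_sub_exp_neg_two_mul_pos ht).ne'
  have h1 : ∀ x, inner ℝ v (ouDensityGrad t x y) =
      (Real.exp (-t) / (1 - Real.exp (-2 * t))) * (ouDensity t x y * inner ℝ v x)
        - (inner ℝ v y / (1 - Real.exp (-2 * t))) * ouDensity t x y := fun x => by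
    rw [ouDensityGrad, inner_smul_right, inner_sub_right, inner_smul_right]
    field_simp
    ring
  have h2 := (integrable_ouTilt_iff ht ρ y _).mp (integrable_inner_ouTilt ht ρ y v)
  rw [real_inner_comm, ouLawDensityGrad, ← integral_inner (integrable_ouDensityGrad ht ρ y)]
  simp only [h1]
  rw [integral_sub (h2.const_mul _) ((integrable_ouDensity ht ρ y).const_mul _),
    integral_const_mul, integral_const_mul, ← integral_ouTilt ht, ← ouLawDensity]
  ring

theorem isRelDensity_ouLaw (ht : 0 < t) (ν μ : Measure E) [IsProbabilityMeasure ν]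
    [IsProbabilityMeasure μ] :
    IsRelDensity (ouLaw ν t) (ouLaw μ t) (fun y => ouLawDensity ν t y / ouLawDensity μ t y)
      (fun y => (ouLawDensity ν t y / ouLawDensity μ t y) •
        ((ouLawDensity ν t y)⁻¹ • ouLawDensityGrad ν t y
          - (ouLawDensity μ t y)⁻¹ • ouLawDensityGrad μ t y)) := by
  have hν := ouLawDensity_pos ht ν
  have hμ := ouLawDensity_pos ht μ
  have hcν := continuous_ouLawDensity ht ν
  have hcμ := continuous_ouLawDensity ht μ
  refine ⟨fun y => (div_pos (hν y) (hμ y)).le, ?_,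
    hasWeakGradient_of_hasGradientAt (fun y => ?_) ?_⟩
  · rw [ouLaw_eq_withDensity ht, ouLaw_eq_withDensity ht, ← withDensity_mul _
      (by fun_prop) (by fun_prop)]
    congr 1 with y
    rw [Pi.mul_apply, ← ENNReal.ofReal_mul (hμ y).le, mul_div_cancel₀ _ (hμ y).ne']
  · have h1 := (hasGradientAt_ouLawDensity ht ν y).hasFDerivAt
    have h2 := (hasGradientAt_ouLawDensity ht μ y).hasFDerivAt
    rw [hasGradientAt_iff_hasFDerivAt]
    simp only [div_eq_mul_inv]
    refine (h1.mul ((hasDerivAt_inv (hμ y).ne').comp_hasFDerivAt y h2)).congr_fderiv ?_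
    ext v
    have := (hν y).ne'
    have := (hμ y).ne'
    simp
    field_simp
    ring
  · exact (hcν.div hcμ fun y => (hμ y).ne').smul
      (((hcν.inv₀ fun y => (hν y).ne').smul (continuous_ouLawDensityGrad ht ν)).sub
        ((hcμ.inv₀ fun y => (hμ y).ne').smul (continuous_ouLawDensityGrad ht μ)))

/-- The common kernel cancels and only normalizing constants remain, so `f⁻¹ • G` is unchanged.
Absolute continuity of `μ` turns Lebesgue-a.e. measurability of `f` into `μ`-a.e. measurability. -/
theorem IsRelDensity.ouTilt (ht : 0 < t) {ν μ : Measure E} [IsProbabilityMeasure ν]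
    [IsProbabilityMeasure μ] (hac : μ ≪ volume) {f : E → ℝ} {G : E → E}
    (h : IsRelDensity ν μ f G) (y : E) :
    IsRelDensity (ouTilt ν y t) (ouTilt μ y t)
      (fun x => (ouLawDensity μ t y / ouLawDensity ν t y) * f x)
      (fun x => (ouLawDensity μ t y / ouLawDensity ν t y) • G x) := by
  have hν := ouLawDensity_pos ht ν y
  have hμ := ouLawDensity_pos ht μ y
  have hq : Measurable fun x => ENNReal.ofReal (ouDensity t x y) :=
    (continuous_ouDensity_left t y).measurable.ennreal_ofReal
  have hf : AEMeasurable (fun x => ENNReal.ofReal (f x)) μ :=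
    (h.weakGradient.1.aestronglyMeasurable.mono_ac hac).aemeasurable.ennreal_ofReal
  refine ⟨fun x => mul_nonneg (div_pos hμ hν).le (h.nonneg x), ?_, h.weakGradient.const_mul _⟩
  have h1 : ν.withDensity (fun x => ENNReal.ofReal (ouDensity t x y)) =
      (μ.withDensity fun x => ENNReal.ofReal (ouDensity t x y)).withDensity
        fun x => ENNReal.ofReal (f x) := by
    conv_lhs => rw [h.eq_withDensity]
    rw [← withDensity_mul₀ hf hq.aemeasurable, mul_comm, withDensity_mul₀ hq.aemeasurable hf]
  have h2 : (fun x => ENNReal.ofReal (ouLawDensity μ t y / ouLawDensity ν t y * f x)) =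
      ENNReal.ofReal (ouLawDensity μ t y / ouLawDensity ν t y) •
        fun x => ENNReal.ofReal (f x) := by
    ext x
    rw [ENNReal.ofReal_mul (div_pos hμ hν).le]
    rfl
  rw [ouTilt_eq_withDensity ht, ouTilt_eq_withDensity ht, h1, h2,
    withDensity_smul' _ _ ENNReal.ofReal_ne_top, withDensity_smul_measure, smul_smul,
    ← ENNReal.ofReal_inv_of_pos hν, ← ENNReal.ofReal_inv_of_pos hμ,
    ← ENNReal.ofReal_mul (div_pos hμ hν).le]
  congr 2
  field_simp

/-! ### Contraction of the relative score -/

theorem fisherInfoTop_ouLaw_le (ht : 0 < t) {ν μ : Measure E} [IsProbabilityMeasure ν]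
    [IsProbabilityMeasure μ] (hac : μ ≪ volume) {lam : ℝ} (hlam : 0 < lam)
    (hLSI : ∀ y, LogSobolev (ouTilt μ y t) lam) {f : E → ℝ} {G : E → E}
    (h : IsRelDensity ν μ f G) {L : ℝ} (hL0 : 0 ≤ L)
    (hL : ∀ᵐ x ∂ν, ‖(f x)⁻¹ • G x‖ₑ ≤ ENNReal.ofReal L) :
    fisherInfoTop (ouLaw ν t) (ouLaw μ t) ≤
      (ENNReal.ofReal (Real.exp t * lam / (Real.exp (2 * t) - 1)) * ENNReal.ofReal L) ^ 2 := by
  have hs := one_sub_exp_neg_two_mul_pos ht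
  have hc : 0 < Real.exp (-t) / (1 - Real.exp (-2 * t)) := by positivity
  have he : Real.exp t * lam / (Real.exp (2 * t) - 1)
      = Real.exp (-t) / (1 - Real.exp (-2 * t)) * lam := by
    have h0 : 0 < Real.exp (2 * t) - 1 := sub_pos.mpr (Real.one_lt_exp_iff.mpr (by linarith))
    have h1 : Real.exp t * (1 - Real.exp (-2 * t)) = Real.exp (-t) * (Real.exp (2 * t) - 1) := by
      rw [mul_sub, mul_sub, ← Real.exp_add, ← Real.exp_add]
      ring_nf
    rw [div_mul_eq_mul_div, div_eq_div_iff h0.ne' hs.ne']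
    linear_combination lam * h1
  refine (fisherInfoTop_le (isRelDensity_ouLaw ht ν μ)).trans ?_
  gcongr
  rw [eLpNorm_exponent_top]
  refine eLpNormEssSup_le_of_ae_enorm_bound (.of_forall fun y => ?_)
  have hν := ouLawDensity_pos ht ν y
  have hμ := ouLawDensity_pos ht μ y
  have := isProbabilityMeasure_ouTilt ht ν y
  have := isProbabilityMeasure_ouTilt ht μ y
  rw [inv_smul_smul₀ (div_pos hν hμ).ne']
  set S := (ouLawDensity ν t y)⁻¹ • ouLawDensityGrad ν t y
    - (ouLawDensity μ t y)⁻¹ • ouLawDensityGrad μ t y with hS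
  -- The rescaled score `w` is the difference of the two tilted means; the terms in `y` from
  -- Tweedie's formula cancel.
  have hw := (hLSI y).norm_le_of_inner_eq hlam (integrable_exp_inner_ouTilt ht μ y)
    (integrable_inner_ouTilt ht ν y) (h.ouTilt ht hac y) hL0
    (w := (Real.exp (-t) / (1 - Real.exp (-2 * t)))⁻¹ • S) ?_ fun v => ?_
  · rw [norm_smul, norm_inv, Real.norm_of_nonneg hc.le, inv_mul_le_iff₀ hc] at hw
    rw [← ENNReal.ofReal_mul (he ▸ by positivity), he, mul_assoc, ← ofReal_norm]
    exact ENNReal.ofReal_le_ofReal hw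
  · have hk := (div_pos hμ hν).ne'
    filter_upwards [(ouTilt_absolutelyContinuous ht ν y).ae_le hL] with x hx
    rwa [mul_inv_rev, mul_smul, inv_smul_smul₀ hk]
  · have := hν.ne'
    have := hμ.ne'
    rw [hS, real_inner_smul_left, inner_sub_left, real_inner_smul_left, real_inner_smul_left,
      inner_ouLawDensityGrad ht, inner_ouLawDensityGrad ht, inv_mul_cancel_left₀ ‹_›,
      inv_mul_cancel_left₀ ‹_›]
    have := hs.ne'
    generalize 1 - Real.exp (-2 * t) = σ at *
    field_simp
    ring

end OrnsteinUhlenbeck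

theorem mainTheorem7 {d : ℕ} (μ ν : Measure (EuclideanSpace ℝ (Fin d)))
    [IsProbabilityMeasure μ] [IsProbabilityMeasure ν] (hμ : μ ≪ volume)
    (lam : ℝ → ℝ) (hlam : ∀ t : ℝ, 0 ≤ t → 0 < lam t)
    (hLSI : ∀ (y : EuclideanSpace ℝ (Fin d)) (t : ℝ), 0 < t → LogSobolev (ouTilt μ y t) (lam t))
    (s : ℝ) (hs : 0 ≤ s) :
    fisherInfoTop (ouLaw ν s) (ouLaw μ s) ^ (1 / 2 : ℝ) ≤
      ENNReal.ofReal (Real.exp s * lam s) / ENNReal.ofReal (Real.exp (2 * s) - 1) *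
        fisherInfoTop ν μ ^ (1 / 2 : ℝ) := by
  have hpos : 0 < Real.exp s * lam s := mul_pos (Real.exp_pos s) (hlam s hs)
  rcases hs.eq_or_lt with rfl | hs'
  · have htop : ENNReal.ofReal (Real.exp 0 * lam 0) / ENNReal.ofReal (Real.exp (2 * 0) - 1) = ⊤ := by
      rw [mul_zero, Real.exp_zero, sub_self, ENNReal.ofReal_zero, ENNReal.div_zero]
      simpa using hlam 0 le_rfl
    rw [htop]
    simp only [ouLaw, if_true]
    -- Only `1 ≤ ⊤` is used, which also covers the case `⊤ * 0 = 0`.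
    exact le_mul_of_one_le_left' le_top
  have hden : 0 < Real.exp (2 * s) - 1 := sub_pos.mpr (Real.one_lt_exp_iff.mpr (by linarith))
  rw [← ENNReal.ofReal_div_of_pos hden]
  set C := ENNReal.ofReal (Real.exp s * lam s / (Real.exp (2 * s) - 1)) with hC
  have hC0 : C ≠ 0 := by simpa [hC] using div_pos hpos hden
  have hCt : C ≠ ⊤ := ENNReal.ofReal_ne_top
  have hkey : fisherInfoTop (ouLaw ν s) (ouLaw μ s) ≤ C ^ 2 * fisherInfoTop ν μ := by
    -- Moving `C ^ 2` to the left exposes the infimum on the right, reducing to a single pair `(f,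
    -- G)`.
    rw [mul_comm, ← ENNReal.div_le_iff (pow_ne_zero 2 hC0) (ENNReal.pow_ne_top hCt)]
    refine le_iInf fun f => le_iInf fun G => le_iInf fun h => ?_
    rw [ENNReal.div_le_iff (pow_ne_zero 2 hC0) (ENNReal.pow_ne_top hCt), mul_comm, ← mul_pow]
    set N := eLpNorm (fun x => (f x)⁻¹ • G x) ⊤ ν with hN
    rcases eq_or_ne N ⊤ with hNt | hNt
    · rw [hNt, ENNReal.mul_top hC0]
      exact le_top
    rw [← ENNReal.ofReal_toReal hNt]
    refine fisherInfoTop_ouLaw_le hs' hμ (hlam s hs) (fun y => hLSI y s hs') h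
      ENNReal.toReal_nonneg ?_
    rw [ENNReal.ofReal_toReal hNt, hN, eLpNorm_exponent_top]
    exact enorm_ae_le_eLpNormEssSup _ _
  calc _ ≤ (C ^ 2 * fisherInfoTop ν μ) ^ (1 / 2 : ℝ) := by gcongr
    _ = _ := by
      rw [ENNReal.mul_rpow_of_nonneg _ _ (by norm_num), ← ENNReal.rpow_natCast, ← ENNReal.rpow_mul]
      norm_num
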